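/- For a semigroup $S$ let $S^1$ denote $S$ with an identity element adjoined if necessary. For $x,y\in S$ and $z_1,z_2,\dots\in S^1$ define $\lambda_0=x$, $\rho_0=y$ and $$\lambda_{n+1}=\lambda_n z_{n+1}\rho_n,\qquad \rho_{n+1}=\rho_n z_{n+1}\lambda_n .$$ The semigroup $S$ is called nilpotent (in the sense of Mal'cev) if there is an integer $n\ge 1$ such that $\lambda_n(a,b,c_1,\dots,c_n)=\rho_n(a,b,c_1,\dots,c_n)$ for all $a,b\in S$ and $c_1,\dots,c_n\in S^1$. Let $\mathbf{MN}$ be the class of all finite nilpotent semigroups. Let $\eta_1$ be the equality relation on $S$, and for $n>1$ let $x\,\eta_n\,y$ mean that there exist $z_1,\dots,z_n\in S^1$ with $x=\lambda_n(x,y,z_1,\dots,z_n)$ and $y=\rho_n(x,y,z_1,\dots,z_n)$. Let $\eta$ be the transitive closure of $\bigcup_{n\ge 1}\eta_n$, and let $\eta^{\ast}$ be the smallest congruence on $S$ containing $\eta$. An inverse of $x\in S$ is an element $y\in S$ with $xyx=x$ and $yxy=y$; a semigroup is a block group if each of its elements has at most one inverse. A subgroup of a semigroup is a subsemigroup that is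 a group under the induced multiplication. Let $\mathbf{BG}_{nil}$ be the class of all finite block groups all of whose subgroups are nilpotent groups. **Theorem.** For every finite semigroup $S$, the quotient $S/\eta^{\ast}$ belongs to $\mathbf{BG}_{nil}$. Consequently, $\mathbf{MN}\subseteq\mathbf{BG}_{nil}$. -/

import Mathlib

universe u

namespace MalcevSemigroup

/-- The pair `(λ_n, ρ_n)` formed from `x`, `y` and `z₁, …, z_n`, computed in `S¹`, where
`z k` stands for `z_{k+1}` (so only `z 0, …, z (n - 1)` matter):
`λ_0 = x`, `ρ_0 = y`, `λ_{n+1} = λ_n z_{n+1} ρ_n`, `ρ_{n+1} = ρ_n z_{n+1} λ_n`.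
`S¹` is `WithOne S`; if `S` already has an identity `e`, the adjoined `1` acts on `S` exactly as
`e` does, and each `z_k` only occurs between two elements of `S`, so that nothing changes. -/
def lamRho {S : Type u} [Semigroup S] (x y : S) (z : ℕ → WithOne S) : ℕ → WithOne S × WithOne S
  | 0 => (x, y)
  | n + 1 => ((lamRho x y z n).1 * z n * (lamRho x y z n).2,
      (lamRho x y z n).2 * z n * (lamRho x y z n).1)

/-- `λ_n(x, y, z₁, …, z_n)`. -/
def lam {S : Type u} [Semigroup S] (n : ℕ) (x y : S) (z : ℕ → WithOne S) : WithOne S :=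
  (lamRho x y z n).1

/-- `ρ_n(x, y, z₁, …, z_n)`. -/
def rho {S : Type u} [Semigroup S] (n : ℕ) (x y : S) (z : ℕ → WithOne S) : WithOne S :=
  (lamRho x y z n).2

/-- Nilpotency of a semigroup in the sense of Mal'cev. -/
def IsMalcevNilpotent (S : Type u) [Semigroup S] : Prop :=
  ∃ n : ℕ, 1 ≤ n ∧ ∀ (a b : S) (c : ℕ → WithOne S), lam n a b c = rho n a b c

/-- The relations `η_n`, `n ≥ 1`: `η_1` is equality, and for `n > 1`, `x η_n y` means
`x = λ_n(x, y, z₁, …, z_n)` and `y = ρ_n(x, y, z₁, …, z_n)` for some `z₁, …, z_n ∈ S¹`. -/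
def etaRel {S : Type u} [Semigroup S] (n : ℕ) (x y : S) : Prop :=
  (n = 1 ∧ x = y) ∨
    (1 < n ∧ ∃ z : ℕ → WithOne S, (x : WithOne S) = lam n x y z ∧ (y : WithOne S) = rho n x y z)

/-- `η`: the transitive closure of the union of the `η_n`, `n ≥ 1`. -/
def eta {S : Type u} [Semigroup S] : S → S → Prop :=
  Relation.TransGen fun x y => ∃ n : ℕ, 1 ≤ n ∧ etaRel n x y

/-- `η*`: the smallest congruence on `S` containing `η`. -/
def etaStar (S : Type u) [Semigroup S] : Con S :=
  conGen eta

/-- `y` is an inverse of `x` in the semigroup `S`. -/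
def IsInverseOf {S : Type u} [Semigroup S] (y x : S) : Prop :=
  x * y * x = x ∧ y * x * y = y

/-- A block group: a semigroup in which each element has at most one inverse. -/
def IsBlockGroup (S : Type u) [Semigroup S] : Prop :=
  ∀ x y y' : S, IsInverseOf y x → IsInverseOf y' x → y = y'

/-- All subgroups of the semigroup `S` (the subsemigroups which are groups under the induced
multiplication, with any idempotent as identity) are nilpotent groups. -/
def SubgroupsNilpotent (S : Type u) [Semigroup S] : Prop :=
  ∀ (H : Subsemigroup S) (G : Type u) [Group G], Nonempty (G ≃* H) → Group.IsNilpotent G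

/-- Membership in the class `MN` of finite semigroups that are nilpotent in the sense of
Mal'cev. -/
def MN (S : Type u) [Semigroup S] : Prop :=
  Finite S ∧ IsMalcevNilpotent S

/-- Membership in the class `BG_nil` of finite block groups all of whose subgroups are
nilpotent. -/
def BGnil (S : Type u) [Semigroup S] : Prop :=
  Finite S ∧ IsBlockGroup S ∧ SubgroupsNilpotent S

end MalcevSemigroup

namespace MalcevSemigroup

section PairSeq

variable {S : Type u} [Semigroup S]

/-! Both claims reduce to two facts: `S / η*` is Mal'cev nilpotent, and nilpotency forces the block
group property and nilpotent subgroups (`MN.bgnil`). By finiteness, a failure of nilpotency yields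
an off-diagonal pair returning to itself after `n` steps. If this happens in `S / η*`, lift the pair
and the parameters: the lifted `n`-step map acts on a finite fibre of `S × S`, hence has a periodic
point there. Its coordinates are `η`-related, so the original pair was diagonal
(`isMalcevNilpotent_etaStar_quotient`). -/

/-- The product `x * z * y` with `z ∈ S¹`, as an element of `S`. -/
def sandwich (x : S) (z : WithOne S) (y : S) : S :=
  WithOne.recOneCoe (motive := fun _ => S) (x * y) (fun s => x * s * y) z

@[simp]
theorem sandwich_one (x y : S) : sandwich x 1 y = x * y := rfl

@[simp]
theorem sandwich_coe (x z y : S) : sandwich x (z : WithOne S) y = x * z * y := rfl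

theorem coe_sandwich (x : S) (z : WithOne S) (y : S) :
    ((sandwich x z y : S) : WithOne S) = x * z * y := by
  induction z using WithOne.recOneCoe with
  | one => simp
  | coe z => simp

theorem map_sandwich {T : Type*} [Semigroup T] (f : S →ₙ* T) (x : S) (z : WithOne S) (y : S) :
    f (sandwich x z y) = sandwich (f x) (WithOne.mapMulHom f z) (f y) := by
  induction z using WithOne.recOneCoe with
  | one => simp
  | coe z => simp

/-- The pair `(λ_n, ρ_n)` as a pair of elements of `S`, starting from the pair `p`. -/
def pairSeq (z : ℕ → WithOne S) : ℕ → S × S → S × S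
  | 0, p => p
  | n + 1, p => (sandwich (pairSeq z n p).1 (z n) (pairSeq z n p).2,
      sandwich (pairSeq z n p).2 (z n) (pairSeq z n p).1)

theorem lamRho_eq (z : ℕ → WithOne S) (n : ℕ) (p : S × S) :
    lamRho p.1 p.2 z n = (((pairSeq z n p).1 : WithOne S), ((pairSeq z n p).2 : WithOne S)) := by
  induction n with
  | zero => rfl
  | succ n ih => simp [lamRho, pairSeq, ih, coe_sandwich]

theorem lam_eq (z : ℕ → WithOne S) (n : ℕ) (p : S × S) :
    lam n p.1 p.2 z = ((pairSeq z n p).1 : WithOne S) := by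
  rw [lam, lamRho_eq]

theorem rho_eq (z : ℕ → WithOne S) (n : ℕ) (p : S × S) :
    rho n p.1 p.2 z = ((pairSeq z n p).2 : WithOne S) := by
  rw [rho, lamRho_eq]

theorem isMalcevNilpotent_iff : IsMalcevNilpotent S ↔
    ∃ n : ℕ, 1 ≤ n ∧ ∀ (p : S × S) (c : ℕ → WithOne S),
      (pairSeq c n p).1 = (pairSeq c n p).2 := by
  refine exists_congr fun n => and_congr_right fun _ => ⟨fun h p c => ?_, fun h a b c => ?_⟩
  · have := h p.1 p.2 c
    rwa [lam_eq, rho_eq, WithOne.coe_inj] at this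
  · rw [lam_eq c n (a, b), rho_eq c n (a, b), h]

theorem pairSeq_add (z : ℕ → WithOne S) (m n : ℕ) (p : S × S) :
    pairSeq z (m + n) p = pairSeq (fun k => z (m + k)) n (pairSeq z m p) := by
  induction n with
  | zero => rfl
  | succ n ih => rw [← add_assoc, pairSeq, pairSeq, ih]

theorem pairSeq_congr {z w : ℕ → WithOne S} {n : ℕ} (h : ∀ k < n, z k = w k) (p : S × S) :
    pairSeq z n p = pairSeq w n p := by
  induction n with
  | zero => rfl
  | succ n ih =>
    rw [pairSeq, pairSeq, ih fun k hk => h k (hk.trans n.lt_succ_self), h n n.lt_succ_self]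

/-- Repeating the parameters periodically turns a cycle of the `n`-step map into a single sequence,
as `η` requires. -/
theorem pairSeq_mod (z : ℕ → WithOne S) (n k : ℕ) (p : S × S) :
    pairSeq (fun i => z (i % n)) (n * k) p = (pairSeq z n)^[k] p := by
  induction k with
  | zero => rfl
  | succ k ih =>
    rw [Nat.mul_succ, pairSeq_add, ih, Function.iterate_succ_apply']
    exact pairSeq_congr (fun i hi => by rw [Nat.mul_add_mod, Nat.mod_eq_of_lt hi]) _

theorem map_pairSeq {T : Type*} [Semigroup T] (f : S →ₙ* T) (z : ℕ → WithOne S) (n : ℕ)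
    (p : S × S) :
    Prod.map f f (pairSeq z n p) =
      pairSeq (fun k => WithOne.mapMulHom f (z k)) n (Prod.map f f p) := by
  induction n with
  | zero => rfl
  | succ n ih => simp [pairSeq, ← ih, map_sandwich]

theorem pairSeq_fst_eq_snd_of_le {z : ℕ → WithOne S} {m n : ℕ} (hmn : m ≤ n) {p : S × S}
    (h : (pairSeq z m p).1 = (pairSeq z m p).2) : (pairSeq z n p).1 = (pairSeq z n p).2 := by
  induction n, hmn using Nat.le_induction with
  | base => exact h
  | succ n _ ih => simp [pairSeq, ih]

/-- A finite semigroup in which every periodic pair is diagonal is nilpotent. -/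
theorem isMalcevNilpotent_of_periodic [Finite S]
    (h : ∀ (z : ℕ → WithOne S) (n : ℕ) (p : S × S), 0 < n → pairSeq z n p = p → p.1 = p.2) :
    IsMalcevNilpotent S := by
  rw [isMalcevNilpotent_iff]
  -- Pigeonhole: one more index than there are pairs forces a repetition.
  refine ⟨Nat.card (S × S) + 1, by omega, fun p c => ?_⟩
  have hni : ¬ Function.Injective
      (fun i : Fin (Nat.card (S × S) + 1) => pairSeq c i p) := fun hi => by
    have := Nat.card_le_card_of_injective _ hi
    simp at this
  obtain ⟨i, j, hij, hlt⟩ : ∃ i j : Fin (Nat.card (S × S) + 1),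
      pairSeq c i p = pairSeq c j p ∧ i < j := by
    simp only [Function.Injective, not_forall] at hni
    obtain ⟨i, j, hij, hne⟩ := hni
    rcases lt_or_gt_of_ne hne with hlt | hlt
    · exact ⟨i, j, hij, hlt⟩
    · exact ⟨j, i, hij.symm, hlt⟩
  have hlt' : (i : ℕ) < j := hlt
  refine pairSeq_fst_eq_snd_of_le (m := i) (by omega)
    (h (fun k => c (i + k)) (j - i) _ (by omega) ?_)
  rw [← pairSeq_add, Nat.add_sub_cancel' hlt'.le, hij]

/-- A periodic pair of `S` is identified in `S / η*`. -/
theorem etaStar_of_pairSeq_eq {z : ℕ → WithOne S} {n : ℕ} (hn : 1 < n) {p : S × S}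
    (h : pairSeq z n p = p) : etaStar S p.1 p.2 :=
  ConGen.Rel.of _ _ <| .single ⟨n, hn.le, .inr ⟨hn, z, by rw [lam_eq, h], by rw [rho_eq, h]⟩⟩

theorem withOne_mapMulHom_surjective {T : Type*} [Semigroup T] {f : S →ₙ* T}
    (hf : Function.Surjective f) : Function.Surjective (WithOne.mapMulHom f) := by
  intro w
  induction w using WithOne.recOneCoe with
  | one => exact ⟨1, map_one _⟩
  | coe t =>
    obtain ⟨s, rfl⟩ := hf t
    exact ⟨s, WithOne.mapMulHom_coe f s⟩

/-- The projection onto `S / η*`. -/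
def etaStarMk (S : Type u) [Semigroup S] : S →ₙ* (etaStar S).Quotient where
  toFun x := (x : (etaStar S).Quotient)
  map_mul' _ _ := rfl

theorem etaStarMk_surjective : Function.Surjective (etaStarMk S) := Quotient.mk_surjective

instance finite_etaStar_quotient [Finite S] : Finite (etaStar S).Quotient :=
  .of_surjective _ etaStarMk_surjective

theorem isMalcevNilpotent_etaStar_quotient [Finite S] :
    IsMalcevNilpotent (etaStar S).Quotient := by
  refine isMalcevNilpotent_of_periodic fun w n q hn hq => ?_
  choose z hz using fun k => withOne_mapMulHom_surjective etaStarMk_surjective (w k)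
  obtain ⟨p, rfl⟩ := (etaStarMk_surjective (S := S)).prodMap etaStarMk_surjective q
  -- The orbit of the lift never leaves the fibre over the periodic pair.
  have hfib : ∀ k, Prod.map (etaStarMk S) (etaStarMk S) ((pairSeq z n)^[k] p) =
      Prod.map (etaStarMk S) (etaStarMk S) p := by
    intro k
    induction k with
    | zero => rfl
    | succ k ih => rw [Function.iterate_succ_apply', map_pairSeq, ih, funext hz, hq]
  obtain ⟨i, j, hlt, hij⟩ :=
    Set.finite_univ.exists_lt_map_eq_of_forall_mem (f := fun k => (pairSeq z n)^[k] p)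
      fun _ => Set.mem_univ _
  have hper : Function.IsPeriodicPt (pairSeq z n) (j - i) ((pairSeq z n)^[i] p) := by
    change (pairSeq z n)^[j - i] _ = _
    rw [← Function.iterate_add_apply, Nat.sub_add_cancel hlt.le]
    exact hij.symm
  -- Running through the cycle twice makes the length exceed 1, since `η_1` is mere equality.
  have hlen : 1 < n * ((j - i) * 2) := by
    have := Nat.mul_pos hn (Nat.sub_pos_of_lt hlt)
    rw [← mul_assoc]
    omega
  have key := etaStar_of_pairSeq_eq hlen
    ((pairSeq_mod z n ((j - i) * 2) _).trans (hper.mul_const 2))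
  have hi := hfib i
  rw [Prod.ext_iff] at hi
  have hquot : etaStarMk S ((pairSeq z n)^[i] p).1 = etaStarMk S ((pairSeq z n)^[i] p).2 :=
    (Con.eq _).2 key
  exact hi.1.symm.trans (hquot.trans hi.2)

/-- With all parameters 1, the pair `(e, f)` is fixed. -/
theorem IsMalcevNilpotent.eq_of_mul_eq_left (hS : IsMalcevNilpotent S) {e f : S}
    (hef : e * f = e) (hfe : f * e = f) : e = f := by
  obtain ⟨n, -, h⟩ := isMalcevNilpotent_iff.1 hS
  have key : ∀ n, pairSeq (fun _ => 1) n (e, f) = (e, f) := by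
    intro n
    induction n with
    | zero => rfl
    | succ n ih => simp [pairSeq, ih, hef, hfe]
  simpa [key] using h (e, f) fun _ => 1

/-- With all parameters 1, each step swaps `e` and `f`. -/
theorem IsMalcevNilpotent.eq_of_mul_eq_right (hS : IsMalcevNilpotent S) {e f : S}
    (hef : e * f = f) (hfe : f * e = e) : e = f := by
  obtain ⟨n, -, h⟩ := isMalcevNilpotent_iff.1 hS
  have key : ∀ n, pairSeq (fun _ => 1) n (e, f) = (e, f) ∨
      pairSeq (fun _ => 1) n (e, f) = (f, e) := by
    intro n
    induction n with
    | zero => exact .inl rfl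
    | succ n ih => rcases ih with ih | ih <;> simp [pairSeq, ih, hef, hfe]
  have := h (e, f) fun _ => 1
  rcases key n with hn | hn <;> rw [hn] at this
  exacts [this, this.symm]

/-- The idempotents `yx`, `y'x` are L-related and `xy`, `xy'` are R-related, so they coincide in
pairs; then `y = yxy = y'xy = y'xy' = y'`. -/
theorem IsMalcevNilpotent.isBlockGroup (hS : IsMalcevNilpotent S) : IsBlockGroup S := by
  rintro x y y' ⟨h1, h2⟩ ⟨h1', h2'⟩
  have hl : y * x = y' * x := hS.eq_of_mul_eq_left
    (by rw [mul_assoc, ← mul_assoc x, h1']) (by rw [mul_assoc, ← mul_assoc x, h1])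
  have hr : x * y = x * y' := hS.eq_of_mul_eq_right
    (by rw [← mul_assoc, h1]) (by rw [← mul_assoc, h1'])
  rw [← h2, hl, mul_assoc, hr, ← mul_assoc, h2']

theorem IsMalcevNilpotent.of_injective {T : Type*} [Semigroup T] (f : T →ₙ* S)
    (hf : Function.Injective f) (hS : IsMalcevNilpotent S) :
    IsMalcevNilpotent T := by
  rw [isMalcevNilpotent_iff] at hS ⊢
  obtain ⟨n, hn, h⟩ := hS
  refine ⟨n, hn, fun p c => hf ?_⟩
  have := h (Prod.map f f p) fun k => WithOne.mapMulHom f (c k)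
  rwa [← map_pairSeq] at this

end PairSeq

/-- The quotient `λ_n ρ_n⁻¹` runs through the left-normed commutators of length `n + 1`. -/
theorem mem_upperCentralSeries_of_pairSeq {G : Type*} [Group G] (n : ℕ) (p : G × G)
    (h : ∀ c : ℕ → WithOne G, (pairSeq c n p).1 = (pairSeq c n p).2) :
    p.1 * p.2⁻¹ ∈ Subgroup.upperCentralSeries G n := by
  induction n generalizing p with
  | zero => simpa [mul_inv_eq_one, pairSeq] using h 1
  | succ n ih =>
    rw [Subgroup.mem_upperCentralSeries_succ_iff]
    intro g
    -- With first parameter `p.2⁻¹ * g` and `u = p.1 * p.2⁻¹`, the new quotient is the commutator `u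
    -- * g * u⁻¹ * g⁻¹`.
    have := ih (p.1 * (p.2⁻¹ * g) * p.2, p.2 * (p.2⁻¹ * g) * p.1) fun c => by
      let z : ℕ → WithOne G := fun k => Nat.casesOn k ((p.2⁻¹ * g : G) : WithOne G) c
      have hz := h z
      rw [add_comm, pairSeq_add] at hz
      simp only [add_comm 1] at hz
      exact hz
    convert this using 1
    group

theorem IsMalcevNilpotent.group_isNilpotent {G : Type*} [Group G] (hG : IsMalcevNilpotent G) :
    Group.IsNilpotent G := by
  obtain ⟨n, -, h⟩ := isMalcevNilpotent_iff.1 hG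
  refine ⟨n, (Subgroup.eq_top_iff' _).2 fun g => ?_⟩
  simpa using mem_upperCentralSeries_of_pairSeq n (g, 1) fun c => h _ c

theorem MN.bgnil {S : Type u} [Semigroup S] (hS : MN S) : BGnil S := by
  refine ⟨hS.1, hS.2.isBlockGroup, fun H G _ ⟨e⟩ => ?_⟩
  exact (hS.2.of_injective ((MulMemClass.subtype H).comp e.toMulHom)
    (Subtype.val_injective.comp e.injective)).group_isNilpotent

end MalcevSemigroup

theorem mainTheorem6 :
    (∀ (S : Type u) [Semigroup S] [Finite S],
      MalcevSemigroup.BGnil (MalcevSemigroup.etaStar S).Quotient) ∧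
    (∀ (S : Type u) [Semigroup S], MalcevSemigroup.MN S → MalcevSemigroup.BGnil S) :=
  ⟨fun _ _ _ => MalcevSemigroup.MN.bgnil ⟨MalcevSemigroup.finite_etaStar_quotient,
    MalcevSemigroup.isMalcevNilpotent_etaStar_quotient⟩, fun _ _ => MalcevSemigroup.MN.bgnil⟩
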